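/- **Setting.** Let $(\Omega,\mathcal F,\mathbb P)$ be a probability space with a filtration $(\mathcal B_n)_{n\ge 0}$, and let $\mu_n\colon\mathbb R^M\to[0,\infty)$, $n\ge 0$, be random Borel functions such that $\mu_n$ is $\mathcal B_n$-measurable (jointly in $(\omega,x)$). Let $(\Gamma,d)$ be a totally bounded metric space and $\{\eta_t\}_{t\in\Gamma}$ a family of locally finite Borel measures on $\mathbb R^M$. Write $$\mu_n^t(A)=\int_A\mu_n\,d\eta_t,\qquad Y_n^t=\mu_n^t(\mathbb R^M)=\int\mu_n\,d\eta_t .$$ Let $\mathcal Q_n$ be the family of half-open dyadic cubes of $\mathbb R^M$ of side length $2^{-n}$. *Martingale measure.* $(\mu_n)$ is a martingale measure if $\mu_0$ is a deterministic bounded function with bounded support, there is $C<\infty$ such that $\mu_{n+1}(x)\le C\mu_n(x)$ for all $n,x$ (almost surely), and $\mathbb E(\mu_{n+1}(x)\mid\mathcal B_n)=\mu_n(x)$ almost surely for every $n$ and $x\in\mathbb R^M$. *Dependency degree.* A graph with vertex set $I$ is a dependency graph for random variables $(X_i)_{i\in I}$ if $X_i$ is independent of $(X_j)_{j\in J}$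 whenever $i\in I$ and $J\subset I$ contains neither $i$ nor a neighbour of $i$. The dependency degree $\mathcal{DI}_n$ is the ($\mathcal B_n$-dependent) smallest $\Psi$ such that for all $t\in\Gamma$ the family $(\mu_{n+1}^t(Q))_{Q\in\mathcal Q_{n+1}}$, under its conditional law given $\mathcal B_n$, has a dependency graph of degree at most $\Psi$; inequalities $\mathcal{DI}_n\le\Psi$ are understood almost surely for each $t$. *WSDM.* A martingale measure $(\mu_n)$ is a weakly spatially dependent martingale (WSDM) with parameter $\delta\ge0$ with respect to $\{\eta_t\}$ if there are random variables $\Psi(n)\in[0,\infty]$ with $\mathcal{DI}_n\le\Psi(n)$ for all $n$, such that for each $\varepsilon>0$ there are a deterministic $C>0$, numbers $\varepsilon_n>0$ with $\sum_n\varepsilon_n<\varepsilon$, and events $\mathfrak C_n\in\mathcal B_n$ with $\mathfrak C_0=\Omega$, $\mathfrak C_n\subset\{\Psi(n)\le C2^{\delta n}\}$ for $n\ge1$, and, for $n\ge1$, $\mathbb P(\mathfrak C_n\mid\mathcal B_{n-1})\ge1-\varepsilon_n$ almost surely on $\mathfrak C_{n-1}$. **Theorem.** Let $(\mu_n)$ be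 a WSDM with parameter $\delta\ge0$ with respect to $\{\eta_t\}_{t\in\Gamma}$, and let $\alpha,\kappa,\gamma>0$. Suppose that: 1. (size) there are constants $C,D$ such that for every $r\in(0,1]$, $\Gamma$ can be covered by at most $Cr^{-D}$ balls of radius $r$; 2. (Frostman) there is $C>0$ with $\eta_t(B(x,r))\le Cr^\kappa$ for all $t\in\Gamma$, $x\in\mathbb R^M$, $0<r<1$, where $B(x,r)$ is the closed ball; 3. (density) almost surely $\mu_n(x)\le2^{\alpha n}$ for all $n\in\mathbb N$ and $x\in\mathbb R^M$; 4. (finite approximation with exponent $\gamma$) there are deterministic finite sets $\Gamma_n\subset\Gamma$ and a constant $a$ with $|\Gamma_n|\le e^{an}$ for $n\ge1$, such that almost surely there are $K\in\mathbb N$ and $C<\infty$ with $$\sup_{t\in\Gamma}Y_n^t\le\sup_{t\in\Gamma_n}Y_n^t+C2^{\gamma n}\qquad\text{for all }n\ge K .$$ If $0<\alpha+\delta-\kappa<\gamma$, then almost surely $$\sup_{n\in\mathbb N,\,t\in\Gamma}2^{-\gamma n}Y_n^t<\infty .$$ -/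

import Mathlib

open MeasureTheory ProbabilityTheory
open scoped NNReal ENNReal

namespace SpatialMartingale

/-- The Euclidean space `ℝ^M`. -/
abbrev Space (M : ℕ) : Type := EuclideanSpace ℝ (Fin M)

/-! ### Slices -/

/-- The slice measure `A ↦ ∫_A f dη` of a density `f` by a measure `η`. With `f = μ_n` and
`η = η_t` this is `μ_n^t`. -/
noncomputable def slice {M : ℕ} (f : Space M → ℝ≥0) (η : Measure (Space M)) :
    Measure (Space M) :=
  η.withDensity fun x => (f x : ℝ≥0∞)

/-- The total mass of the slice. With `f = μ_n` and `η = η_t` this is `Y_n^t = ‖μ_n^t‖`. -/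
noncomputable def sliceMass {M : ℕ} (f : Space M → ℝ≥0) (η : Measure (Space M)) : ℝ≥0∞ :=
  slice f η Set.univ

/-- The half-open dyadic cube of side length `2^{-n}` with lower corner `2^{-n} k`. The family
`𝒬_n` is `{dyadicCube n k : k ∈ ℤ^M}`. -/
def dyadicCube {M : ℕ} (n : ℕ) (k : Fin M → ℤ) : Set (Space M) :=
  {x | ∀ i, (k i : ℝ) / 2 ^ n ≤ x i ∧ x i < ((k i : ℝ) + 1) / 2 ^ n}

/-- The masses that the slice of `f` by `η` gives to all dyadic cubes of side length `2^{-n}`. -/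
noncomputable def cubeMasses {M : ℕ} (n : ℕ) (f : Space M → ℝ≥0) (η : Measure (Space M)) :
    (Fin M → ℤ) → ℝ≥0∞ :=
  fun k => slice f η (dyadicCube n k)

/-! ### Martingale measures -/

/-- `(μ_n)` is a martingale measure on `ℝ^M` adapted to the filtration `ℬ`. -/
structure IsMartingaleMeasure {Ω : Type*} {mΩ : MeasurableSpace Ω} {M : ℕ} (P : Measure Ω)
    (ℬ : Filtration ℕ mΩ) (μ : ℕ → Ω → Space M → ℝ≥0) : Prop where
  /-- `μ_0` is a deterministic bounded function with bounded support. -/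
  initial : ∃ f : Space M → ℝ≥0, (∃ R : ℝ≥0, ∀ x, f x ≤ R) ∧
    Bornology.IsBounded (Function.support f) ∧ ∀ᵐ ω ∂P, μ 0 ω = f
  /-- The random Borel function `μ_n` is `ℬ_n`-measurable. -/
  measurable : ∀ n, Measurable[MeasurableSpace.prod (ℬ n) inferInstance]
    fun p : Ω × Space M => μ n p.1 p.2
  /-- The quotients `μ_{n+1} / μ_n` are uniformly bounded. -/
  quotients_bounded : ∃ C : ℝ≥0, ∀ᵐ ω ∂P, ∀ n x, μ (n + 1) ω x ≤ C * μ n ω x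
  /-- The martingale condition, at every point. -/
  martingale : ∀ n x, P[fun ω => (μ (n + 1) ω x : ℝ) | ℬ n] =ᵐ[P] fun ω => (μ n ω x : ℝ)

/-! ### Dependency graphs and weak spatial dependence -/

/-- `G` is a dependency graph for the family `(X_i)` of random variables on the probability space
`(S, ν)`: each `X_i` is independent of every subfamily `(X_j)_{j ∈ J}` such that `J` contains
neither `i` nor a neighbour of `i`. -/
def IsDependencyGraph {I S E : Type*} [MeasurableSpace S] [MeasurableSpace E]
    (X : I → S → E) (ν : Measure S) (G : SimpleGraph I) : Prop :=
  ∀ (i : I) (J : Set I), i ∉ J → (∀ j ∈ J, ¬ G.Adj i j) →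
    IndepFun (X i) (fun s (j : J) => X j s) ν

/-- The smallest possible maximal degree of a dependency graph for `(X_i)`. -/
noncomputable def dependencyDegree {I S E : Type*} [MeasurableSpace S] [MeasurableSpace E]
    (X : I → S → E) (ν : Measure S) : ℕ∞ :=
  ⨅ (G : SimpleGraph I) (_ : IsDependencyGraph X ν G), ⨆ i, (G.neighborSet i).encard

/-- The regular conditional distribution of `Y` given the σ-algebra `m`. -/
noncomputable def condLaw {Ω S : Type*} {mΩ : MeasurableSpace Ω} [MeasurableSpace S]
    [StandardBorelSpace S] [Nonempty S] (P : Measure Ω) [IsProbabilityMeasure P]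
    (m : MeasurableSpace Ω) (Y : Ω → S) (ω : Ω) : Measure S :=
  (@condDistrib Ω Ω S _ _ _ mΩ m Y id P _) ω

/-- The smallest degree of a dependency graph for the family
`{μ_{n+1}^t(Q) | ℬ_n}_{Q ∈ 𝒬_{n+1}}` (where `η = η_t`) at the realization `ω` of `ℬ_n`: the degree
is that of the coordinates under the conditional joint law of the masses given `ℬ_n`. -/
noncomputable def condDependencyDegree {Ω : Type*} {mΩ : MeasurableSpace Ω} {M : ℕ}
    (P : Measure Ω) [IsProbabilityMeasure P] (ℬ : Filtration ℕ mΩ)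
    (μ : ℕ → Ω → Space M → ℝ≥0) (η : Measure (Space M)) (n : ℕ) (ω : Ω) : ℕ∞ :=
  dependencyDegree (fun (k : Fin M → ℤ) (y : (Fin M → ℤ) → ℝ≥0∞) => y k)
    (condLaw P (ℬ n) (fun ω' => cubeMasses (n + 1) (μ (n + 1) ω') η) ω)

/-- The dependency degree `𝒟ℐ_n` of `(μ_n)` with respect to `{η_t}` is at most the random number
`Ψ`. Conditional laws are only determined almost surely, separately for each `t`, so the bound is
required almost surely for each `t`; it therefore does not depend on their versions. -/
def DependencyDegreeLE {Ω Γ : Type*} {mΩ : MeasurableSpace Ω} {M : ℕ}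
    (P : Measure Ω) [IsProbabilityMeasure P] (ℬ : Filtration ℕ mΩ)
    (μ : ℕ → Ω → Space M → ℝ≥0) (η : Γ → Measure (Space M)) (n : ℕ) (Ψ : Ω → ℝ≥0∞) : Prop :=
  ∀ t, ∀ᵐ ω ∂P, (condDependencyDegree P ℬ μ (η t) n ω : ℝ≥0∞) ≤ Ψ ω

/-- `(μ_n)` is weakly spatially dependent with parameter `δ` with respect to `{η_t}`. The events
`A n` are the good events on which `Ψ(n) ≤ C 2^{δ n}`; conditionally on `ℬ_n`, on `A n` the next
event `A (n + 1)` has probability at least `1 - ε_{n+1}`. -/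
def IsWeaklySpatiallyDependent {Ω Γ : Type*} {mΩ : MeasurableSpace Ω} {M : ℕ}
    (P : Measure Ω) [IsProbabilityMeasure P] (ℬ : Filtration ℕ mΩ)
    (μ : ℕ → Ω → Space M → ℝ≥0) (η : Γ → Measure (Space M)) (δ : ℝ) : Prop :=
  ∃ Ψ : ℕ → Ω → ℝ≥0∞, (∀ n, Measurable (Ψ n)) ∧
    (∀ n, DependencyDegreeLE P ℬ μ η n (Ψ n)) ∧
    ∀ ε : ℝ, 0 < ε → ∃ (C : ℝ) (e : ℕ → ℝ) (A : ℕ → Set Ω),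
      0 < C ∧ (∀ n, 0 < e n) ∧ Summable e ∧ ∑' n, e n < ε ∧
      A 0 = Set.univ ∧ (∀ n, MeasurableSet[ℬ n] (A n)) ∧
      (∀ n, 1 ≤ n → ∀ ω ∈ A n, Ψ n ω ≤ ENNReal.ofReal (C * (2 : ℝ) ^ (δ * (n : ℝ)))) ∧
      ∀ n, ∀ᵐ ω ∂P, ω ∈ A n → 1 - e (n + 1) ≤ (P⟦A (n + 1) | ℬ n⟧) ω

/-- `(μ_n)` is a weakly spatially dependent martingale (WSDM) with parameter `δ`. -/
structure IsWSDM {Ω Γ : Type*} {mΩ : MeasurableSpace Ω} {M : ℕ}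
    (P : Measure Ω) [IsProbabilityMeasure P] (ℬ : Filtration ℕ mΩ)
    (μ : ℕ → Ω → Space M → ℝ≥0) (η : Γ → Measure (Space M)) (δ : ℝ) : Prop where
  martingaleMeasure : IsMartingaleMeasure P ℬ μ
  weaklyDependent : IsWeaklySpatiallyDependent P ℬ μ η δ

/-! ### Hypotheses on the parameter space, the measures and the densities -/

/-- `Γ` has finite upper box-counting dimension: it is covered by `O(1) r^{-O(1)}` balls of
radius `r`, for all `r ∈ (0,1]`. -/
def HasFiniteBoxDimension (Γ : Type*) [MetricSpace Γ] : Prop :=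
  ∃ C D : ℝ, ∀ r : ℝ, 0 < r → r ≤ 1 → ∃ s : Finset Γ,
    (s.card : ℝ) ≤ C * r ^ (-D) ∧ Set.univ ⊆ ⋃ t ∈ s, Metric.closedBall t r

/-- The family `{η_t}` has Frostman exponent `κ`, with a uniform constant. -/
def HasFrostmanExponent {Γ : Type*} {M : ℕ} (η : Γ → Measure (Space M)) (κ : ℝ) : Prop :=
  ∃ C : ℝ, 0 < C ∧ ∀ (t : Γ) (x : Space M) (r : ℝ), 0 < r → r < 1 →
    η t (Metric.closedBall x r) ≤ ENNReal.ofReal (C * r ^ κ)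

/-- The finite approximation condition with exponent `γ`: there are deterministic `Γ_n ⊆ Γ` with at
most `exp(O(n))` elements such that almost surely
`sup_{t ∈ Γ} Y_n^t ≤ sup_{t ∈ Γ_n} Y_n^t + O(2^{γ n})` for all large `n`. -/
def HasFiniteApproximation {Ω Γ : Type*} {mΩ : MeasurableSpace Ω} {M : ℕ} (P : Measure Ω)
    (μ : ℕ → Ω → Space M → ℝ≥0) (η : Γ → Measure (Space M)) (γ : ℝ) : Prop :=
  ∃ F : ℕ → Finset Γ, (∃ a : ℝ, ∀ n, 1 ≤ n → ((F n).card : ℝ) ≤ Real.exp (a * n)) ∧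
    ∀ᵐ ω ∂P, ∃ (K : ℕ) (C : ℝ), ∀ n, K ≤ n →
      (⨆ t, sliceMass (μ n ω) (η t)) ≤
        (⨆ t ∈ F n, sliceMass (μ n ω) (η t)) + ENNReal.ofReal (C * (2 : ℝ) ^ (γ * (n : ℝ)))

end SpatialMartingale

/-! Fix `t` and condition on `ℬ n`. The mass `Y_{n+1}^t` is a finite sum of cube masses with means
`b_k = μ_n^t(Q_k)`, each at most `L * b_k`, and density and Frostman bounds give `b_k ≤
O(2^{(α-κ)n})`. On a good event the dependency degree is `O(2^{δn})`. Colouring the dependency graph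
splits the sum into that many sums of independent terms, so the centred sum is sub-Gaussian with
variance proxy `O(2^{(α+δ-κ)n}) Y_n^t` (`IsDependencyGraph.hasSubgaussianMGF_sum`).

A deviation of size `ρ (Y_n^t + 2^{γn})` therefore has probability at most `exp(-c
2^{(γ-(α+δ-κ))n})` (`exists_forall_measure_sliceMass_succ_ge_le`). As `α+δ-κ < γ`, this beats the
exponential number of parameters in the approximating sets, and Borel–Cantelli controls all of them
for large `n` (`ae_eventually_sliceMass_succ_le`).

Finite approximation passes to `T_n = sup_t Y_n^t`: eventually `T_{n+1} ≤ (1+ρ) T_n + O(2^{γn})`.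
With `1+ρ < 2^γ`, the sequence `2^{-γn} T_n` obeys an affine contraction and is bounded
(`iSup_lt_top_of_contraction`). All good events hold simultaneously outside a set of probability
`ε`, and `ε` is arbitrary. -/

namespace ProbabilityTheory.HasSubgaussianMGF

/-! ### Sub-Gaussian sums without independence. -/

variable {Ω : Type*} {mΩ : MeasurableSpace Ω} {ν : Measure Ω}

theorem mono {X : Ω → ℝ} {c c' : ℝ≥0} (h : HasSubgaussianMGF X c ν) (hc : c ≤ c') :
    HasSubgaussianMGF X c' ν where
  integrable_exp_mul := h.integrable_exp_mul
  mgf_le t := (h.mgf_le t).trans <| by gcongr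

/-- The square roots of sub-Gaussian parameters are subadditive, without independence. -/
theorem sum_sqrt [IsProbabilityMeasure ν] {ι : Type*} {X : ι → Ω → ℝ} {c : ι → ℝ≥0}
    (s : Finset ι) (h : ∀ i ∈ s, HasSubgaussianMGF (X i) (c i) ν) :
    HasSubgaussianMGF (fun ω => ∑ i ∈ s, X i ω) ((∑ i ∈ s, (c i).sqrt) ^ 2) ν := by
  classical
  induction s using Finset.induction_on with
  | empty => simp
  | insert i s hi ih =>
    have h2 := ih fun j hj => h j (Finset.mem_insert_of_mem hj)
    have h3 := (h i (Finset.mem_insert_self i s)).add h2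
    simpa [Finset.sum_insert hi, NNReal.sqrt_sq] using h3

/-- Cauchy–Schwarz applied to `sum_sqrt`. It serves to recombine the colour classes, where the
cardinality is the number of colours. -/
theorem sum_card_mul [IsProbabilityMeasure ν] {ι : Type*} {X : ι → Ω → ℝ} {c : ι → ℝ≥0}
    (s : Finset ι) (h : ∀ i ∈ s, HasSubgaussianMGF (X i) (c i) ν) :
    HasSubgaussianMGF (fun ω => ∑ i ∈ s, X i ω) (s.card * ∑ i ∈ s, c i) ν := by
  refine (sum_sqrt s h).mono ?_
  have := sq_sum_le_card_mul_sum_sq (s := s) (f := fun i => (NNReal.sqrt (c i) : ℝ≥0))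
  simpa using this

end ProbabilityTheory.HasSubgaussianMGF

/-! ### Concentration under a dependency graph. -/

namespace SpatialMartingale

/-- Greedy colouring of a finite set of vertices of a graph of degree at most `d`. -/
theorem exists_coloring_on_finset {I : Type*} (G : SimpleGraph I) {d : ℕ}
    (hd : ∀ i, (G.neighborSet i).encard ≤ d) (s : Finset I) :
    ∃ col : I → Fin (d + 1), ∀ i ∈ s, ∀ j ∈ s, G.Adj i j → col i ≠ col j := by
  classical
  induction s using Finset.induction_on with
  | empty => exact ⟨fun _ => 0, by simp⟩
  | insert i s hi ih =>
    obtain ⟨col, hcol⟩ := ih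
    have hfin : (G.neighborSet i).Finite := Set.finite_of_encard_le_coe (hd i)
    have hcard : (hfin.toFinset.image col).card < (Finset.univ : Finset (Fin (d + 1))).card := by
      refine Finset.card_image_le.trans_lt ?_
      have := hd i
      rw [hfin.encard_eq_coe_toFinset_card] at this
      simp only [Finset.card_univ, Fintype.card_fin]
      exact Nat.lt_succ_of_le (by exact_mod_cast this)
    obtain ⟨e, -, he⟩ := Finset.exists_mem_notMem_of_card_lt_card hcard
    have he' : ∀ j, G.Adj i j → col j ≠ e := fun j hj h =>
      he (Finset.mem_image.2 ⟨j, by simpa using hj, h⟩)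
    refine ⟨Function.update col i e, ?_⟩
    have hne : ∀ j ∈ s, j ≠ i := fun j hj h => hi (h ▸ hj)
    intro j hj k hk hjk
    rcases Finset.mem_insert.1 hj with hj' | hj' <;> rcases Finset.mem_insert.1 hk with hk' | hk'
    · exact absurd (hj'.trans hk'.symm) hjk.ne
    · rw [hj', Function.update_self, Function.update_of_ne (hne k hk')]
      exact (he' k (hj' ▸ hjk)).symm
    · rw [hk', Function.update_self, Function.update_of_ne (hne j hj')]
      exact he' j (hk' ▸ hjk.symm)
    · rw [Function.update_of_ne (hne j hj'), Function.update_of_ne (hne k hk')]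
      exact hcol j hj' k hk' hjk

section

variable {I S E : Type*} [MeasurableSpace S] [MeasurableSpace E] {ν : Measure S}
  [IsProbabilityMeasure ν] {X : I → S → E} {G : SimpleGraph I}

/-- A dependency graph separates each variable from the joint law of its non-neighbours, so on a set
without edges the variables can be split off one at a time and the parameters add. -/
theorem IsDependencyGraph.hasSubgaussianMGF_sum_of_independent (hG : IsDependencyGraph X ν G)
    {f : I → E → ℝ} (hf : ∀ i, Measurable (f i)) {c : I → ℝ≥0} (s : Finset I)
    (hs : ∀ i ∈ s, ∀ j ∈ s, ¬ G.Adj i j)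
    (h : ∀ i ∈ s, HasSubgaussianMGF (fun ω => f i (X i ω)) (c i) ν) :
    HasSubgaussianMGF (fun ω => ∑ i ∈ s, f i (X i ω)) (∑ i ∈ s, c i) ν := by
  classical
  induction s using Finset.induction_on with
  | empty => simp
  | insert i s hi ih =>
    have h2 := ih (fun j hj k hk => hs j (Finset.mem_insert_of_mem hj) k
      (Finset.mem_insert_of_mem hk)) fun j hj => h j (Finset.mem_insert_of_mem hj)
    have hind := hG i (s : Set I) (by simpa using hi)
      (fun j hj => hs i (Finset.mem_insert_self i s) j (Finset.mem_insert_of_mem hj))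
    have hind' := hind.comp (hf i)
      (show Measurable fun (z : ↥(s : Set I) → E) => ∑ j : ↥(s : Set I), f j (z j) from
        Finset.measurable_sum _ fun j _ => (hf j).comp (measurable_pi_apply j))
    have heq : ((fun (z : ↥(s : Set I) → E) => ∑ j : ↥(s : Set I), f j (z j)) ∘
        fun ω (j : ↥(s : Set I)) => X j ω) = fun ω => ∑ j ∈ s, f j (X j ω) := by
      funext ω
      exact Finset.sum_coe_sort s fun j => f j (X j ω)
    rw [heq] at hind'
    simpa [Finset.sum_insert hi] using
      (h i (Finset.mem_insert_self i s)).add_of_indepFun h2 hind'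

/-- Janson's inequality, at the level of moment generating functions. -/
theorem IsDependencyGraph.hasSubgaussianMGF_sum (hG : IsDependencyGraph X ν G) {d : ℕ}
    (hd : ∀ i, (G.neighborSet i).encard ≤ d)
    {f : I → E → ℝ} (hf : ∀ i, Measurable (f i)) {c : I → ℝ≥0} (s : Finset I)
    (h : ∀ i ∈ s, HasSubgaussianMGF (fun ω => f i (X i ω)) (c i) ν) :
    HasSubgaussianMGF (fun ω => ∑ i ∈ s, f i (X i ω)) ((d + 1) * ∑ i ∈ s, c i) ν := by
  classical
  obtain ⟨col, hcol⟩ := exists_coloring_on_finset G hd s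
  have key := HasSubgaussianMGF.sum_card_mul (ν := ν) (Finset.univ : Finset (Fin (d + 1)))
    (X := fun q ω => ∑ i ∈ s with col i = q, f i (X i ω))
    (c := fun q => ∑ i ∈ s with col i = q, c i) fun q _ => by
      refine hG.hasSubgaussianMGF_sum_of_independent hf _ ?_ ?_
      · intro i hi j hj hij
        simp only [Finset.mem_filter] at hi hj
        exact hcol i hi.1 j hj.1 hij (hi.2.trans hj.2.symm)
      · intro i hi
        exact h i (Finset.mem_of_mem_filter i hi)
  simpa [Finset.sum_fiberwise] using key

end

/-- The infimum is attained because degrees are discrete: a graph of degree below `d + 1` has degree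
at most `d`. -/
theorem exists_isDependencyGraph_of_dependencyDegree_le {I S E : Type*} [MeasurableSpace S]
    [MeasurableSpace E] {X : I → S → E} {ν : Measure S} {D : ℝ≥0}
    (h : (dependencyDegree X ν : ℝ≥0∞) ≤ D) :
    ∃ (G : SimpleGraph I) (d : ℕ), IsDependencyGraph X ν G ∧ (d : ℝ≥0) ≤ D ∧
      ∀ i, (G.neighborSet i).encard ≤ d := by
  have hne : dependencyDegree X ν ≠ ⊤ := by
    intro h'
    rw [h'] at h
    simp at h
  obtain ⟨d, hd⟩ := ENat.ne_top_iff_exists.1 hne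
  have hlt : dependencyDegree X ν < (d : ℕ∞) + 1 := by
    rw [← hd]
    exact_mod_cast Nat.lt_succ_self d
  unfold dependencyDegree at hlt
  simp only [iInf_lt_iff] at hlt
  obtain ⟨G, hG, hlt⟩ := hlt
  refine ⟨G, d, hG, ?_, fun i => ?_⟩
  · rw [← hd] at h
    simpa using h
  · exact (le_iSup (fun i => (G.neighborSet i).encard) i).trans (Order.le_of_lt_add_one hlt)

/-- Upper tail bound for a finite sum of bounded random masses with small dependency degree. -/
theorem measure_sum_ge_le_of_dependencyDegree_le {I : Type*} {ν : Measure (I → ℝ≥0∞)}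
    [IsProbabilityMeasure ν] (s : Finset I) (b : I → ℝ≥0) {L r D c : ℝ≥0} {l : ℝ}
    (hmean : ∀ k ∈ s, ∫⁻ y, y k ∂ν = b k)
    (hle : ∀ k ∈ s, ∀ᵐ (y : I → ℝ≥0∞) ∂ν, y k ≤ (L : ℝ≥0∞) * b k)
    (hdeg : (dependencyDegree (fun (k : I) (y : I → ℝ≥0∞) => y k) ν : ℝ≥0∞) ≤ D)
    (hr : ∀ k ∈ s, b k ≤ r) (hc : (D + 1) * (L ^ 2 * r * ∑ k ∈ s, b k) ≤ c) (hl : 0 ≤ l) :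
    ν {y | ENNReal.ofReal l + ∑ k ∈ s, (b k : ℝ≥0∞) ≤ ∑ k ∈ s, y k} ≤
      ENNReal.ofReal (Real.exp (-l ^ 2 / (2 * c))) := by
  classical
  obtain ⟨G, d, hG, hdD, hd⟩ := exists_isDependencyGraph_of_dependencyDegree_le hdeg
  have hint : ∀ k ∈ s, ∫ y, (y k).toReal ∂ν = b k := by
    intro k hk
    rw [integral_toReal (measurable_pi_apply k).aemeasurable, hmean k hk]
    · simp
    · filter_upwards [hle k hk] with y hy
      exact hy.trans_lt (ENNReal.mul_lt_top ENNReal.coe_lt_top ENNReal.coe_lt_top)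
  have hsub : ∀ k ∈ s, HasSubgaussianMGF (fun y : I → ℝ≥0∞ => (y k).toReal - b k)
      (L ^ 2 * r * b k) ν := by
    intro k hk
    have h1 := hasSubgaussianMGF_of_mem_Icc (μ := ν) (X := fun y : I → ℝ≥0∞ => (y k).toReal)
      (a := 0) (b := L * b k) (measurable_pi_apply k).ennreal_toReal.aemeasurable (by
        filter_upwards [hle k hk] with y hy
        refine ⟨ENNReal.toReal_nonneg, ?_⟩
        simpa using ENNReal.toReal_mono (ENNReal.mul_ne_top ENNReal.coe_ne_top
          ENNReal.coe_ne_top) hy)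
    rw [hint k hk] at h1
    refine h1.mono ?_
    have h2 : ‖(L : ℝ) * b k - 0‖₊ = L * b k := by
      ext; simp
    rw [h2]
    -- Only one of the two factors `b k` is replaced by `r`, which keeps the summed parameter linear
    -- in the total mean mass.
    have h3 : L ^ 2 * b k * b k ≤ L ^ 2 * r * b k := by gcongr; exact hr k hk
    refine le_trans ?_ h3
    calc (L * b k / 2) ^ 2 ≤ (L * b k) ^ 2 := by
          gcongr; exact NNReal.half_le_self _
      _ = _ := by ring
  have hsum := hG.hasSubgaussianMGF_sum hd (f := fun k e => e.toReal - b k)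
    (fun k => by fun_prop) s hsub
  have hsum' := hsum.mono (c' := c) (le_trans (by rw [← Finset.mul_sum]; gcongr) hc)
  have hfin : ∀ᵐ y ∂ν, ∀ k ∈ s, y k ≠ ∞ := by
    rw [Filter.eventually_all_finset]
    intro k hk
    filter_upwards [hle k hk] with y hy
    exact (hy.trans_lt (ENNReal.mul_lt_top ENNReal.coe_lt_top ENNReal.coe_lt_top)).ne
  refine (measure_mono_ae (t := {y : I → ℝ≥0∞ | l ≤ ∑ k ∈ s, ((y k).toReal - (b k : ℝ))}) ?_).trans ?_
  · filter_upwards [hfin] with y hy hmem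
    change ENNReal.ofReal l + ∑ k ∈ s, (b k : ℝ≥0∞) ≤ ∑ k ∈ s, y k at hmem
    change l ≤ ∑ k ∈ s, ((y k).toReal - b k)
    have h1 := ENNReal.toReal_mono (ENNReal.sum_ne_top.2 hy) hmem
    rw [ENNReal.toReal_add ENNReal.ofReal_ne_top (by simp), ENNReal.toReal_ofReal hl,
      ENNReal.toReal_sum (by simp), ENNReal.toReal_sum hy] at h1
    simp only [ENNReal.coe_toReal] at h1
    rw [Finset.sum_sub_distrib]
    linarith
  · rw [← ofReal_measureReal]
    exact ENNReal.ofReal_le_ofReal (hsum'.measure_ge_le hl)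

/-! ### Regular conditional laws. -/

section CondLaw

variable {Ω S : Type*} {m mΩ : MeasurableSpace Ω} [MeasurableSpace S] [StandardBorelSpace S]
  [Nonempty S] {P : Measure Ω} [IsProbabilityMeasure P] {Y : Ω → S}

theorem isProbabilityMeasure_condLaw (ω : Ω) : IsProbabilityMeasure (condLaw P m Y ω) := by
  unfold condLaw
  infer_instance

theorem measurable_lintegral_condLaw {f : Ω × S → ℝ≥0∞}
    (hf : Measurable[m.prod inferInstance] f) :
    Measurable[m] fun ω => ∫⁻ y, f (ω, y) ∂condLaw P m Y ω :=
  @Measurable.lintegral_kernel_prod_right' Ω S m _ _ _ f hf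

/-- Disintegration of the law of `(ω, Y ω)`, with `Ω` as first factor carrying only the σ-algebra
`m`. This lets `m`-measurable thresholds be frozen under the conditional law. -/
theorem lintegral_condLaw (hm : m ≤ mΩ) (hY : Measurable Y) {f : Ω × S → ℝ≥0∞}
    (hf : Measurable[m.prod inferInstance] f) :
    ∫⁻ ω, ∫⁻ y, f (ω, y) ∂condLaw P m Y ω ∂P = ∫⁻ ω, f (ω, Y ω) ∂P := by
  have hid : @Measurable Ω Ω mΩ m id := measurable_id'' hm
  have hpair : @Measurable Ω (Ω × S) mΩ (m.prod inferInstance) fun ω => (id ω, Y ω) :=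
    Measurable.prodMk hid hY
  have key := @compProd_map_condDistrib Ω Ω S _ _ _ mΩ P _ id Y m hY.aemeasurable
  have h1 := congrArg (fun ν => @lintegral _ (m.prod inferInstance) ν f) key
  rw [@Measure.lintegral_compProd _ _ m _ _ _ _ _ _ hf,
    @lintegral_map _ _ mΩ m _ _ _ (@Measurable.lintegral_kernel_prod_right' Ω S m _ _ _ f hf) hid,
    @lintegral_map _ _ mΩ (m.prod inferInstance) _ _ _ hf hpair] at h1
  exact h1

theorem measurable_condLaw_section {D : Set (Ω × S)}
    (hD : MeasurableSet[m.prod inferInstance] D) :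
    Measurable[m] fun ω => condLaw P m Y ω {y | (ω, y) ∈ D} := by
  have h1 : Measurable[m.prod inferInstance] (D.indicator fun _ => (1 : ℝ≥0∞)) :=
    Measurable.indicator (@measurable_const _ _ _ (m.prod inferInstance) 1) hD
  have h := measurable_lintegral_condLaw (P := P) (Y := Y) h1
  convert h using 2 with ω
  exact (lintegral_indicator_one (s := {y | (ω, y) ∈ D})
    ((@measurable_prodMk_left _ _ m _ ω) hD)).symm

theorem lintegral_condLaw_section (hm : m ≤ mΩ) (hY : Measurable Y) {D : Set (Ω × S)}
    (hD : MeasurableSet[m.prod inferInstance] D) :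
    ∫⁻ ω, condLaw P m Y ω {y | (ω, y) ∈ D} ∂P = P {ω | (ω, Y ω) ∈ D} := by
  have h1 : Measurable[m.prod inferInstance] (D.indicator fun _ => (1 : ℝ≥0∞)) :=
    Measurable.indicator (@measurable_const _ _ _ (m.prod inferInstance) 1) hD
  have h := lintegral_condLaw (P := P) (Y := Y) hm hY h1
  have hle : m.prod inferInstance ≤ mΩ.prod (inferInstance : MeasurableSpace S) :=
    sup_le_sup_right (MeasurableSpace.comap_mono hm) _
  refine Eq.trans (lintegral_congr fun ω => ?_) (h.trans
    (lintegral_indicator_one (s := {ω | (ω, Y ω) ∈ D}) ((measurable_id.prodMk hY) (hle D hD))))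
  exact (lintegral_indicator_one (s := {y | (ω, y) ∈ D})
    ((@measurable_prodMk_left _ _ m _ ω) hD)).symm

theorem ae_condLaw_of_ae (hm : m ≤ mΩ) (hY : Measurable Y) {D : Set (Ω × S)}
    (hD : MeasurableSet[m.prod inferInstance] D) (h : ∀ᵐ ω ∂P, (ω, Y ω) ∈ D) :
    ∀ᵐ ω ∂P, ∀ᵐ y ∂condLaw P m Y ω, (ω, y) ∈ D := by
  have hDc : MeasurableSet[m.prod inferInstance] Dᶜ := hD.compl
  have h1 := lintegral_condLaw_section (P := P) hm hY hDc
  rw [show P {ω | (ω, Y ω) ∈ Dᶜ} = 0 from h,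
    lintegral_eq_zero_iff ((measurable_condLaw_section hDc).mono hm le_rfl)] at h1
  exact h1

theorem measure_le_of_condLaw_le (hm : m ≤ mΩ) (hY : Measurable Y) {D : Set (Ω × S)}
    (hD : MeasurableSet[m.prod inferInstance] D) {q : ℝ≥0∞}
    (h : ∀ᵐ ω ∂P, condLaw P m Y ω {y | (ω, y) ∈ D} ≤ q) :
    P {ω | (ω, Y ω) ∈ D} ≤ q := by
  rw [← lintegral_condLaw_section hm hY hD]
  calc _ ≤ ∫⁻ _, q ∂P := lintegral_mono_ae h
    _ = q := by simp

/-- Both sides are `m`-measurable, so equality of integrals over sets of `m` suffices, for the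
trimmed measure. -/
theorem lintegral_condLaw_ae_eq (hm : m ≤ mΩ) (hY : Measurable Y) {f : S → ℝ≥0∞}
    (hf : Measurable f) {g : Ω → ℝ≥0∞} (hg : Measurable[m] g)
    (h : ∀ B, MeasurableSet[m] B → ∫⁻ ω in B, f (Y ω) ∂P = ∫⁻ ω in B, g ω ∂P) :
    ∀ᵐ ω ∂P, ∫⁻ y, f y ∂condLaw P m Y ω = g ω := by
  have hF : Measurable[m.prod inferInstance] fun p : Ω × S => f p.2 :=
    hf.comp (@measurable_snd _ _ m _)
  have hmeas := measurable_lintegral_condLaw (P := P) (Y := Y) hF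
  refine ae_of_ae_trim hm ?_
  refine @ae_eq_of_forall_setLIntegral_eq_of_sigmaFinite Ω m (P.trim hm) _ _ _ hmeas hg ?_
  intro B hB _
  rw [setLIntegral_trim hm hmeas hB, setLIntegral_trim hm hg hB, ← h B hB]
  have hFB : Measurable[m.prod inferInstance]
      ((Prod.fst ⁻¹' B).indicator fun p : Ω × S => f p.2) :=
    Measurable.indicator hF ((@measurable_fst _ _ m _) hB)
  have key := lintegral_condLaw (P := P) hm hY hFB
  rw [← lintegral_indicator (hm B hB), ← lintegral_indicator (hm B hB)]
  refine Eq.trans (lintegral_congr fun ω => ?_) (key.trans (lintegral_congr fun ω => ?_))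
  · by_cases hω : ω ∈ B <;> simp [hω, Set.indicator]
  · by_cases hω : ω ∈ B <;> simp [hω, Set.indicator]

end CondLaw

/-! ### Dyadic cubes. -/

section Cubes

variable {M : ℕ}

theorem measurableSet_dyadicCube (n : ℕ) (k : Fin M → ℤ) : MeasurableSet (dyadicCube n k) := by
  unfold dyadicCube
  simp only [Set.ofPred_forall]
  refine MeasurableSet.iInter fun i => ?_
  have hi : Measurable fun x : Space M => x i := by fun_prop
  exact (measurableSet_le measurable_const hi).inter (measurableSet_lt hi measurable_const)

theorem mem_dyadicCube_iff {n : ℕ} {k : Fin M → ℤ} {x : Space M} :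
    x ∈ dyadicCube n k ↔ ∀ i, ⌊x i * 2 ^ n⌋ = k i := by
  refine forall_congr' fun i => ?_
  have h2 : (0 : ℝ) < 2 ^ n := by positivity
  rw [Int.floor_eq_iff, div_le_iff₀ h2, lt_div_iff₀ h2]

theorem disjoint_dyadicCube {n : ℕ} {k l : Fin M → ℤ} (h : k ≠ l) :
    Disjoint (dyadicCube n k) (dyadicCube n l) := by
  rw [Set.disjoint_left]
  intro x hx hy
  rw [mem_dyadicCube_iff] at hx hy
  exact h (funext fun i => (hx i).symm.trans (hy i))

theorem exists_finset_dyadicCube_cover (n : ℕ) {A : Set (Space M)} (hA : Bornology.IsBounded A) :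
    ∃ s : Finset (Fin M → ℤ), A ⊆ ⋃ k ∈ s, dyadicCube n k := by
  obtain ⟨R, hR⟩ := hA.subset_closedBall 0
  refine ⟨Fintype.piFinset fun _ => Finset.Icc ⌊-R * 2 ^ n⌋ ⌊R * 2 ^ n⌋, fun x hx => ?_⟩
  have hxR : ‖x‖ ≤ R := by simpa using hR hx
  simp only [Set.mem_iUnion, exists_prop]
  refine ⟨fun i => ⌊x i * 2 ^ n⌋, ?_, mem_dyadicCube_iff.2 fun i => rfl⟩
  rw [Fintype.mem_piFinset]
  intro i
  have h1 := abs_le.1 ((PiLp.norm_apply_le x i).trans hxR)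
  rw [Finset.mem_Icc]
  constructor <;> apply Int.floor_mono <;> gcongr
  · exact h1.1
  · exact h1.2

/-- The constant `M + 1` is a crude bound for `√M` that stays positive when `M = 0`. -/
theorem dyadicCube_subset_closedBall (n : ℕ) (k : Fin M → ℤ) :
    ∃ x : Space M, dyadicCube n k ⊆ Metric.closedBall x ((M + 1) / 2 ^ n) := by
  refine ⟨WithLp.toLp 2 fun i => (k i : ℝ) / 2 ^ n, fun y hy => ?_⟩
  have h2 : (0 : ℝ) < 2 ^ n := by positivity
  rw [Metric.mem_closedBall, EuclideanSpace.dist_eq]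
  apply Real.sqrt_le_iff.2 ⟨by positivity, ?_⟩
  calc ∑ i, dist (y i) ((k i : ℝ) / 2 ^ n) ^ 2 ≤ ∑ _i : Fin M, (1 / 2 ^ n : ℝ) ^ 2 := by
        refine Finset.sum_le_sum fun i _ => ?_
        have := hy i
        rw [add_div] at this
        gcongr
        rw [Real.dist_eq, abs_le]
        have hpos : (0 : ℝ) < 1 / 2 ^ n := by positivity
        constructor <;> linarith
    _ = M * (1 / 2 ^ n : ℝ) ^ 2 := by simp
    _ ≤ (M + 1) ^ 2 * (1 / 2 ^ n : ℝ) ^ 2 := by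
        gcongr
        nlinarith [(Nat.cast_nonneg M : (0 : ℝ) ≤ M)]
    _ = _ := by ring

end Cubes

/-! ### Masses of slices and their measurability. -/

section Slices

variable {M : ℕ} {η : Measure (Space M)}

theorem slice_apply (f : Space M → ℝ≥0) {A : Set (Space M)} (hA : MeasurableSet A) :
    slice f η A = ∫⁻ x in A, f x ∂η := withDensity_apply _ hA

theorem slice_le {f : Space M → ℝ≥0} {B : ℝ≥0} (hf : ∀ x, f x ≤ B) {A : Set (Space M)}
    (hA : MeasurableSet A) : slice f η A ≤ B * η A := by
  rw [slice_apply f hA, ← setLIntegral_const]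
  exact lintegral_mono fun x => ENNReal.coe_le_coe.2 (hf x)

theorem slice_mono {f g : Space M → ℝ≥0} {L : ℝ≥0} (h : ∀ x, f x ≤ L * g x)
    {A : Set (Space M)} (hA : MeasurableSet A) : slice f η A ≤ L * slice g η A := by
  rw [slice_apply f hA, slice_apply g hA, ← lintegral_const_mul' _ _ ENNReal.coe_ne_top]
  exact lintegral_mono fun x => (ENNReal.coe_le_coe.2 (h x)).trans_eq (ENNReal.coe_mul _ _)

theorem sliceMass_eq_of_support_subset {f : Space M → ℝ≥0} {A : Set (Space M)}
    (hA : MeasurableSet A) (h : Function.support f ⊆ A) : sliceMass f η = slice f η A := by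
  unfold sliceMass
  rw [slice_apply f hA, slice_apply f MeasurableSet.univ, setLIntegral_univ,
    setLIntegral_eq_of_support_subset]
  intro x hx
  exact h (by simpa using hx)

theorem sliceMass_eq_sum_cubeMasses {f : Space M → ℝ≥0} {n : ℕ} {s : Finset (Fin M → ℤ)}
    (h : Function.support f ⊆ ⋃ k ∈ s, dyadicCube n k) :
    sliceMass f η = ∑ k ∈ s, cubeMasses n f η k := by
  rw [sliceMass_eq_of_support_subset
    (s.measurableSet_biUnion fun k _ => measurableSet_dyadicCube n k) h]
  exact measure_biUnion_finset (fun k _ l _ hkl => disjoint_dyadicCube hkl)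
    fun k _ => measurableSet_dyadicCube n k

theorem measurable_slice [SFinite η] {Ω : Type*} {m : MeasurableSpace Ω} {F : Ω → Space M → ℝ≥0}
    (hF : Measurable[m.prod inferInstance] fun p : Ω × Space M => F p.1 p.2)
    {A : Set (Space M)} (hA : MeasurableSet A) : Measurable[m] fun ω => slice (F ω) η A := by
  simp only [slice_apply _ hA]
  exact @Measurable.lintegral_prod_right' Ω (Space M) m _ (η.restrict A) _
    (fun p => (F p.1 p.2 : ℝ≥0∞)) hF.coe_nnreal_ennreal

theorem measurable_cubeMasses [SFinite η] {Ω : Type*} {m : MeasurableSpace Ω}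
    {F : Ω → Space M → ℝ≥0} (hF : Measurable[m.prod inferInstance] fun p : Ω × Space M => F p.1 p.2)
    (n : ℕ) : Measurable[m] fun ω => cubeMasses n (F ω) η :=
  measurable_pi_lambda _ fun k => measurable_slice hF (measurableSet_dyadicCube n k)

end Slices

/-! ### Consequences of the Frostman bound. -/

section Frostman

variable {Γ : Type*} {M : ℕ} {η : Γ → Measure (Space M)} {κ : ℝ}

/-- The Frostman bound concerns radii below `1`, so `n₀` is taken with `M + 1 < 2 ^ n₀`. -/
theorem HasFrostmanExponent.exists_forall_dyadicCube_le (h : HasFrostmanExponent η κ) :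
    ∃ (C : ℝ) (n₀ : ℕ), 0 < C ∧ ∀ n, n₀ ≤ n → ∀ t k,
      η t (dyadicCube n k) ≤ ENNReal.ofReal (C * (2 : ℝ) ^ (-κ * n)) := by
  obtain ⟨C, hC, hF⟩ := h
  obtain ⟨n₀, hn₀⟩ := pow_unbounded_of_one_lt ((M : ℝ) + 1) (one_lt_two)
  refine ⟨C * (M + 1) ^ κ, n₀, by positivity, fun n hn t k => ?_⟩
  obtain ⟨x, hx⟩ := dyadicCube_subset_closedBall n k
  have h2 : (0 : ℝ) < 2 ^ n := by positivity
  refine (measure_mono hx).trans ((hF t x _ (by positivity) ?_).trans (le_of_eq ?_))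
  · rw [div_lt_one h2]
    exact hn₀.trans_le (pow_le_pow_right₀ one_le_two hn)
  · rw [Real.div_rpow (by positivity) h2.le, ← Real.rpow_natCast, ← Real.rpow_mul zero_le_two,
      neg_mul, Real.rpow_neg zero_le_two, mul_comm κ, div_eq_mul_inv, mul_assoc]

theorem HasFrostmanExponent.exists_forall_bounded_le (h : HasFrostmanExponent η κ)
    {A : Set (Space M)} (hA : Bornology.IsBounded A) :
    ∃ C : ℝ≥0, ∀ t, η t A ≤ C := by
  obtain ⟨C, n₀, hC, hF⟩ := h.exists_forall_dyadicCube_le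
  obtain ⟨s, hs⟩ := exists_finset_dyadicCube_cover n₀ hA
  refine ⟨s.card * Real.toNNReal (C * (2 : ℝ) ^ (-κ * n₀)), fun t => ?_⟩
  calc η t A ≤ ∑ k ∈ s, η t (dyadicCube n₀ k) :=
        (measure_mono hs).trans (measure_biUnion_finset_le s _)
    _ ≤ ∑ _k ∈ s, ENNReal.ofReal (C * (2 : ℝ) ^ (-κ * n₀)) :=
        Finset.sum_le_sum fun k _ => hF n₀ le_rfl t k
    _ = _ := by simp [ENNReal.ofReal]

end Frostman

/-! ### From pointwise martingales to slices. -/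

section Martingale

variable {Ω : Type*} {mΩ : MeasurableSpace Ω} {M : ℕ} {P : Measure Ω}
  {ℬ : Filtration ℕ mΩ} {μ : ℕ → Ω → Space M → ℝ≥0}

theorem IsMartingaleMeasure.measurable_uncurry (hμ : IsMartingaleMeasure P ℬ μ) (n : ℕ) :
    Measurable fun p : Ω × Space M => μ n p.1 p.2 :=
  (hμ.measurable n).mono (sup_le_sup_right (MeasurableSpace.comap_mono (ℬ.le n)) _) le_rfl

theorem IsMartingaleMeasure.measurable_eval (hμ : IsMartingaleMeasure P ℬ μ) (n : ℕ) (x : Space M) :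
    Measurable[ℬ n] fun ω => μ n ω x :=
  (hμ.measurable n).comp (@measurable_prodMk_right _ _ (ℬ n) _ x)

theorem IsMartingaleMeasure.setLIntegral_eval [IsProbabilityMeasure P]
    (hμ : IsMartingaleMeasure P ℬ μ)
    (hbdd : ∀ n, ∃ R : ℝ, ∀ᵐ ω ∂P, ∀ x, (μ n ω x : ℝ) ≤ R) (n : ℕ) (x : Space M) {B : Set Ω}
    (hB : MeasurableSet[ℬ n] B) :
    ∫⁻ ω in B, μ (n + 1) ω x ∂P = ∫⁻ ω in B, μ n ω x ∂P := by
  have hint : ∀ m, Integrable (fun ω => (μ m ω x : ℝ)) P := by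
    intro m
    obtain ⟨R, hR⟩ := hbdd m
    refine Integrable.of_bound (C := R)
      ((hμ.measurable_eval m x).mono (ℬ.le m) le_rfl).coe_nnreal_real.aestronglyMeasurable ?_
    filter_upwards [hR] with ω hω
    simpa using hω x
  have h1 : ∫ ω in B, (μ (n + 1) ω x : ℝ) ∂P = ∫ ω in B, (μ n ω x : ℝ) ∂P := by
    rw [← setIntegral_condExp (ℬ.le n) (hint (n + 1)) hB]
    exact setIntegral_congr_ae (ℬ.le n B hB) ((hμ.martingale n x).mono fun ω h _ => h)
  have h2 : ∀ m, ∫⁻ ω in B, μ m ω x ∂P = ENNReal.ofReal (∫ ω in B, (μ m ω x : ℝ) ∂P) := by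
    intro m
    rw [ofReal_integral_eq_lintegral_ofReal (hint m).integrableOn
      (Filter.Eventually.of_forall fun _ => NNReal.coe_nonneg _)]
    simp
  rw [h2, h2, h1]

/-- Tonelli transfers the pointwise martingale identity to slices. -/
theorem IsMartingaleMeasure.setLIntegral_slice [IsProbabilityMeasure P]
    (hμ : IsMartingaleMeasure P ℬ μ)
    (hbdd : ∀ n, ∃ R : ℝ, ∀ᵐ ω ∂P, ∀ x, (μ n ω x : ℝ) ≤ R) (η : Measure (Space M)) [SFinite η]
    (n : ℕ) {A : Set (Space M)} (hA : MeasurableSet A) {B : Set Ω} (hB : MeasurableSet[ℬ n] B) :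
    ∫⁻ ω in B, slice (μ (n + 1) ω) η A ∂P = ∫⁻ ω in B, slice (μ n ω) η A ∂P := by
  simp only [slice_apply _ hA]
  have hswap : ∀ m, ∫⁻ ω in B, ∫⁻ x in A, μ m ω x ∂η ∂P =
      ∫⁻ x in A, ∫⁻ ω in B, μ m ω x ∂P ∂η := fun m =>
    lintegral_lintegral_swap (hμ.measurable_uncurry m).coe_nnreal_ennreal.aemeasurable
  rw [hswap, hswap]
  exact lintegral_congr fun x => hμ.setLIntegral_eval hbdd n x hB

/-- Almost surely, all densities are supported in one deterministic bounded set. -/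
theorem IsMartingaleMeasure.exists_isBounded_support (hμ : IsMartingaleMeasure P ℬ μ) :
    ∃ A : Set (Space M), Bornology.IsBounded A ∧ MeasurableSet A ∧
      ∀ᵐ ω ∂P, ∀ n, Function.support (μ n ω) ⊆ A := by
  obtain ⟨f, -, hf, h0⟩ := hμ.initial
  obtain ⟨L, hL⟩ := hμ.quotients_bounded
  obtain ⟨R, hR⟩ := hf.subset_closedBall 0
  refine ⟨Metric.closedBall 0 R, Metric.isBounded_closedBall, measurableSet_closedBall, ?_⟩
  filter_upwards [h0, hL] with ω h0 hL n
  induction n with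
  | zero => rwa [h0]
  | succ n ih =>
    refine fun x hx => ih fun h => hx ?_
    simpa [h] using hL n x

end Martingale

/-! ### One-step tail bound for a single slice. -/

section Tail

variable {Ω : Type*} {mΩ : MeasurableSpace Ω} {M : ℕ} {P : Measure Ω} [IsProbabilityMeasure P]
  {ℬ : Filtration ℕ mΩ} {μ : ℕ → Ω → Space M → ℝ≥0}

/-- Conditional tail bound for one step of the mass martingale of a slice. -/
theorem IsMartingaleMeasure.measure_sliceMass_succ_ge_le (hμ : IsMartingaleMeasure P ℬ μ)
    (hbdd : ∀ n, ∃ R : ℝ, ∀ᵐ ω ∂P, ∀ x, (μ n ω x : ℝ) ≤ R) (η : Measure (Space M)) [SFinite η]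
    {n : ℕ} {s : Finset (Fin M → ℤ)}
    (hsupp : ∀ᵐ ω ∂P, ∀ m, Function.support (μ m ω) ⊆ ⋃ k ∈ s, dyadicCube (n + 1) k)
    {L r D K : ℝ≥0} (hL : ∀ᵐ ω ∂P, ∀ x, μ (n + 1) ω x ≤ L * μ n ω x)
    {G : Set Ω} (hG : MeasurableSet[ℬ n] G)
    (hD : ∀ᵐ ω ∂P, ω ∈ G → (condDependencyDegree P ℬ μ η n ω : ℝ≥0∞) ≤ D)
    (hr : ∀ᵐ ω ∂P, ∀ k ∈ s, slice (μ n ω) η (dyadicCube (n + 1) k) ≤ r)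
    (hK : 0 < K) (hDK : (D + 1) * (L ^ 2 * r) ≤ K) (ρ u : ℝ≥0) :
    P {ω | ω ∈ G ∧ (ρ * u : ℝ≥0) + (1 + ρ : ℝ≥0) * sliceMass (μ n ω) η ≤
      sliceMass (μ (n + 1) ω) η} ≤ ENNReal.ofReal (Real.exp (-(ρ ^ 2 * u) / (2 * K))) := by
  set b : Ω → (Fin M → ℤ) → ℝ≥0∞ := fun ω => cubeMasses (n + 1) (μ n ω) η
  set Y : Ω → (Fin M → ℤ) → ℝ≥0∞ := fun ω => cubeMasses (n + 1) (μ (n + 1) ω) η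
  have hYm : Measurable Y := measurable_cubeMasses (hμ.measurable_uncurry (n + 1)) (n + 1)
  have hbm : ∀ k, Measurable[ℬ n] fun ω => b ω k := fun k =>
    measurable_slice (hμ.measurable n) (measurableSet_dyadicCube (n + 1) k)
  have hbm' : ∀ k, Measurable[(ℬ n).prod inferInstance]
      fun p : Ω × ((Fin M → ℤ) → ℝ≥0∞) => b p.1 k := fun k =>
    (hbm k).comp (@measurable_fst _ _ (ℬ n) _)
  have hym : ∀ k, Measurable[(ℬ n).prod inferInstance]
      fun p : Ω × ((Fin M → ℤ) → ℝ≥0∞) => p.2 k := fun k =>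
    (measurable_pi_apply k).comp (@measurable_snd _ _ (ℬ n) _)
  have hmean : ∀ᵐ ω ∂P, ∀ k, ∫⁻ y, y k ∂condLaw P (ℬ n) Y ω = b ω k := by
    rw [ae_all_iff]
    exact fun k => lintegral_condLaw_ae_eq (ℬ.le n) hYm (measurable_pi_apply k) (hbm k)
      fun B hB => hμ.setLIntegral_slice hbdd η n (measurableSet_dyadicCube (n + 1) k) hB
  have hle : ∀ᵐ ω ∂P, ∀ k, ∀ᵐ y ∂condLaw P (ℬ n) Y ω, y k ≤ L * b ω k := by
    rw [ae_all_iff]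
    intro k
    refine ae_condLaw_of_ae (ℬ.le n) hYm (D := {p | p.2 k ≤ L * b p.1 k})
      (measurableSet_le (hym k) ((hbm' k).const_mul _)) ?_
    filter_upwards [hL] with ω hω
    exact slice_mono hω (measurableSet_dyadicCube (n + 1) k)
  have hDm : MeasurableSet[(ℬ n).prod inferInstance] {p : Ω × ((Fin M → ℤ) → ℝ≥0∞) |
      p.1 ∈ G ∧ (ρ * u : ℝ≥0) + (1 + ρ : ℝ≥0) * ∑ k ∈ s, b p.1 k ≤ ∑ k ∈ s, p.2 k} := by
    refine MeasurableSet.inter ((@measurable_fst _ _ (ℬ n) _) hG) ?_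
    exact measurableSet_le (Measurable.const_add (Measurable.const_mul
      (Finset.measurable_fun_sum _ fun k _ => hbm' k) _) _)
      (Finset.measurable_fun_sum _ fun k _ => hym k)
  refine le_trans (measure_mono_ae ?_) (measure_le_of_condLaw_le (ℬ.le n) hYm hDm ?_)
  · filter_upwards [hsupp] with ω hω hmem
    change ω ∈ G ∧ _ at hmem
    change ω ∈ G ∧ _
    rwa [sliceMass_eq_sum_cubeMasses (hω n), sliceMass_eq_sum_cubeMasses (hω (n + 1))] at hmem
  · filter_upwards [hmean, hle, hD, hr] with ω hmean hle hD hr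
    by_cases hω : ω ∈ G
    swap
    · simp [hω]
    have := isProbabilityMeasure_condLaw (P := P) (m := ℬ n) (Y := Y) ω
    have hcoe : ∀ k ∈ s, ((b ω k).toNNReal : ℝ≥0∞) = b ω k := fun k hk =>
      ENNReal.coe_toNNReal ((hr k hk).trans_lt ENNReal.coe_lt_top).ne
    set T : ℝ≥0 := ∑ k ∈ s, (b ω k).toNNReal with hT
    have hTc : (T : ℝ≥0∞) = ∑ k ∈ s, b ω k := by
      rw [hT, ENNReal.ofNNReal_finsetSum]
      exact Finset.sum_congr rfl hcoe
    -- Deviation and variance proxy are both proportional to `T + u`, so the exponent is `-ρ² (T +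
    -- u) / (2K)`; dropping the random `T` leaves a deterministic bound.
    have key := measure_sum_ge_le_of_dependencyDegree_le (ν := condLaw P (ℬ n) Y ω) s
      (fun k => (b ω k).toNNReal) (L := L) (r := r) (D := D) (c := K * (T + u))
      (l := ρ * (T + u)) (fun k hk => by rw [hmean k, hcoe k hk])
      (fun k hk => by rw [hcoe k hk]; exact hle k) (hD hω)
      (fun k hk => by
        rw [← ENNReal.coe_le_coe, hcoe k hk]
        exact hr k hk)
      (by
        rw [← mul_assoc]
        gcongr
        exact le_self_add)
      (by positivity)
    refine (measure_mono ?_).trans (key.trans (ENNReal.ofReal_le_ofReal (Real.exp_le_exp.2 ?_)))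
    · rintro y ⟨-, hy⟩
      rw [← hTc] at hy
      rw [Set.mem_ofPred_eq, Finset.sum_congr rfl hcoe, ← hTc]
      refine le_trans (le_of_eq ?_) hy
      rw [show (ρ : ℝ) * (T + u) = ((ρ * (T + u) : ℝ≥0) : ℝ) by push_cast; ring,
        ENNReal.ofReal_coe_nnreal]
      norm_cast
      ring
    · have hK' : (0 : ℝ) < K := hK
      push_cast
      -- If `T + u = 0`, the quotient `0 / 0` is `0` by convention and `u = 0`, so both exponents
      -- vanish.
      rcases eq_or_lt_of_le (show (0 : ℝ) ≤ T + u by positivity) with h0 | h0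
      · have hu : (u : ℝ) = 0 := by
          have := T.coe_nonneg
          have := u.coe_nonneg
          linarith
        rw [← h0, hu]
        simp
      · rw [show -((ρ : ℝ) * (T + u)) ^ 2 / (2 * (K * (T + u))) =
          -(ρ ^ 2 * (T + u)) / (2 * K) by field_simp]
        gcongr
        have := T.coe_nonneg
        linarith

end Tail

/-! ### Summability and contraction. -/

section RealLemmas

theorem summable_exp_mul_exp_neg_two_rpow (a : ℝ) {c β : ℝ} (hc : 0 < c) (hβ : 0 < β) :
    Summable fun n : ℕ => Real.exp (a * (n + 1 : ℝ)) * Real.exp (-(c * (2 : ℝ) ^ (β * n))) := by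
  have hr : (1 : ℝ) < 2 ^ β := Real.one_lt_rpow one_lt_two hβ
  have h1 : Filter.Tendsto (fun n : ℕ => ((n : ℝ) + 1) / ((2 : ℝ) ^ β) ^ n) Filter.atTop
      (nhds 0) := by
    have h2 := (tendsto_pow_const_div_const_pow_of_one_lt 1 hr).add
      (tendsto_pow_const_div_const_pow_of_one_lt 0 hr)
    simpa [add_div] using h2
  have h3 := h1.eventually_le_const (show (0 : ℝ) < c / (|a| + 1) by positivity)
  refine Summable.of_norm_bounded_eventually_nat (g := fun n : ℕ => Real.exp (-(n : ℝ)))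
    Real.summable_exp_neg_nat ?_
  filter_upwards [h3] with n hn
  rw [← Real.rpow_natCast, ← Real.rpow_mul zero_le_two,
    div_le_div_iff₀ (by positivity) (by positivity)] at hn
  rw [← Real.exp_add, Real.norm_eq_abs, Real.abs_exp, Real.exp_le_exp]
  have h4 : a * (n + 1 : ℝ) ≤ |a| * (n + 1 : ℝ) := by
    gcongr
    exact le_abs_self a
  linarith

/-- The fixed point `c / (1 - q)` of the affine map, enlarged by the finitely many initial values,
is an invariant bound. -/
theorem iSup_lt_top_of_contraction {W : ℕ → ℝ≥0∞} (hW : ∀ n, W n ≠ ∞) {q c : ℝ≥0} (hq : q < 1)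
    {N : ℕ} (h : ∀ n, N ≤ n → W (n + 1) ≤ q * W n + c) : ⨆ n, W n < ∞ := by
  obtain ⟨w, rfl⟩ : ∃ w : ℕ → ℝ≥0, W = fun n => (w n : ℝ≥0∞) :=
    ⟨fun n => (W n).toNNReal, funext fun n => (ENNReal.coe_toNNReal (hW n)).symm⟩
  have h' : ∀ n, N ≤ n → w (n + 1) ≤ q * w n + c := fun n hn => by
    have := h n hn
    dsimp only at this
    exact_mod_cast this
  set B : ℝ≥0 := ∑ m ∈ Finset.range (N + 1), w m + c / (1 - q)
  have hq' : 0 < 1 - q := tsub_pos_of_lt hq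
  have hsmall : ∀ n, n ≤ N → w n ≤ B := fun n hn =>
    (Finset.single_le_sum (f := w) (fun _ _ => zero_le) (Finset.mem_range_succ_iff.2 hn)).trans
      le_self_add
  have hle : ∀ n, w n ≤ B := by
    intro n
    rcases le_total n N with hn | hn
    · exact hsmall n hn
    induction n, hn using Nat.le_induction with
    | base => exact hsmall N le_rfl
    | succ n hn ih =>
      calc w (n + 1) ≤ q * w n + c := h' n hn
        _ ≤ q * B + (1 - q) * B := by
          gcongr
          calc c = (1 - q) * (c / (1 - q)) := by field_simp
            _ ≤ (1 - q) * B := by gcongr; exact le_add_self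
        _ = B := by rw [← add_mul, add_tsub_cancel_of_le hq.le, one_mul]
  exact (iSup_le fun n => ENNReal.coe_le_coe.2 (hle n)).trans_lt ENNReal.coe_lt_top

end RealLemmas

/-- The good events fail with probability at most the sum of the conditional failure bounds. -/
theorem measure_iUnion_compl_le_of_condExp_ge {Ω : Type*} {mΩ : MeasurableSpace Ω} {P : Measure Ω}
    [IsProbabilityMeasure P] {ℬ : Filtration ℕ mΩ} {A : ℕ → Set Ω} {e : ℕ → ℝ}
    (he : ∀ n, 0 < e n) (hs : Summable e) (h0 : A 0 = Set.univ)
    (hA : ∀ n, MeasurableSet[ℬ n] (A n))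
    (h : ∀ n, ∀ᵐ ω ∂P, ω ∈ A n → 1 - e (n + 1) ≤ (P⟦A (n + 1) | ℬ n⟧) ω) :
    P (⋃ n, (A n)ᶜ) ≤ ENNReal.ofReal (∑' n, e n) := by
  have hAm : ∀ n, MeasurableSet (A n) := fun n => ℬ.le n _ (hA n)
  -- Since `A 0` is everything, a point missing some `A n` has a first exit from the good events.
  have hsub : (⋃ n, (A n)ᶜ) ⊆ ⋃ n, A n \ A (n + 1) := by
    intro ω hω
    by_contra hcon
    simp only [Set.mem_iUnion, Set.mem_sdiff, not_exists, not_and, not_not] at hcon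
    obtain ⟨n, hn⟩ := Set.mem_iUnion.1 hω
    refine hn ?_
    clear hn
    induction n with
    | zero => simp [h0]
    | succ n ih => exact hcon n ih
  have hstep : ∀ n, P (A n \ A (n + 1)) ≤ ENNReal.ofReal (e (n + 1)) := by
    intro n
    have hint : Integrable ((A (n + 1)).indicator fun _ => (1 : ℝ)) P :=
      (integrable_const 1).indicator (hAm (n + 1))
    have h1 := setIntegral_condExp (ℬ.le n) hint (hA n)
    rw [integral_indicator_const (1 : ℝ) (hAm (n + 1)), smul_eq_mul, mul_one,
      measureReal_restrict_apply (hAm (n + 1))] at h1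
    have h2 : ∫ _ω in A n, (1 - e (n + 1)) ∂P ≤
        ∫ ω in A n, (P⟦A (n + 1) | ℬ n⟧) ω ∂P := by
      refine setIntegral_mono_on_ae (integrable_const _).integrableOn
        integrable_condExp.integrableOn (hAm n) (h n)
    rw [h1, setIntegral_const, smul_eq_mul] at h2
    have h3 := measureReal_sdiff_add_inter (μ := P) (s := A n) (hAm (n + 1))
    rw [← ofReal_measureReal]
    apply ENNReal.ofReal_le_ofReal
    have h4 : P.real (A n) ≤ 1 := measureReal_le_one
    rw [Set.inter_comm] at h3
    nlinarith [he (n + 1)]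
  calc P (⋃ n, (A n)ᶜ) ≤ ∑' n, P (A n \ A (n + 1)) :=
        (measure_mono hsub).trans (measure_iUnion_le _)
    _ ≤ ∑' n, ENNReal.ofReal (e (n + 1)) := ENNReal.tsum_le_tsum hstep
    _ ≤ ∑' n, ENNReal.ofReal (e n) :=
        ENNReal.tsum_comp_le_tsum_of_injective (add_left_injective 1) _
    _ = _ := (ENNReal.ofReal_tsum_of_nonneg (fun n => (he n).le) hs).symm

/-! ### Bounds uniform over parameters. -/

section

variable {Ω Γ : Type*} {mΩ : MeasurableSpace Ω} {P : Measure Ω} {M : ℕ}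
  {ℬ : Filtration ℕ mΩ} {μ : ℕ → Ω → Space M → ℝ≥0} {η : Γ → Measure (Space M)}
  {α κ δ γ : ℝ}

/-- Only finiteness at each level matters here: the contraction needs finite starting values. -/
theorem IsMartingaleMeasure.ae_iSup_sliceMass_lt_top (hμ : IsMartingaleMeasure P ℬ μ)
    (hfrostman : HasFrostmanExponent η κ)
    (hdensity : ∀ᵐ ω ∂P, ∀ (n : ℕ) (x : Space M), (μ n ω x : ℝ) ≤ (2 : ℝ) ^ (α * (n : ℝ))) :
    ∀ᵐ ω ∂P, ∀ n, (⨆ t, sliceMass (μ n ω) (η t)) < ∞ := by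
  obtain ⟨S, hSb, hSm, hS⟩ := hμ.exists_isBounded_support
  obtain ⟨B, hB⟩ := hfrostman.exists_forall_bounded_le hSb
  filter_upwards [hS, hdensity] with ω hω hd n
  refine (iSup_le fun t => ?_).trans_lt
    (ENNReal.coe_lt_top (r := ((2 : ℝ) ^ (α * (n : ℝ))).toNNReal * B))
  rw [sliceMass_eq_of_support_subset hSm (hω n), ENNReal.coe_mul]
  refine (slice_le (fun x => NNReal.le_toNNReal_of_coe_le (hd n x)) hSm).trans ?_
  gcongr
  exact hB t

variable [IsProbabilityMeasure P]

/-- Uniform tail bound for one step of the mass martingales, on events where the dependency degree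
is `O(2^{δ n})`. -/
theorem IsMartingaleMeasure.exists_forall_measure_sliceMass_succ_ge_le
    (hμ : IsMartingaleMeasure P ℬ μ) (hη : ∀ t, IsLocallyFiniteMeasure (η t)) (hκ : 0 < κ)
    (hδ : 0 ≤ δ) (hfrostman : HasFrostmanExponent η κ)
    (hdensity : ∀ᵐ ω ∂P, ∀ (n : ℕ) (x : Space M), (μ n ω x : ℝ) ≤ (2 : ℝ) ^ (α * (n : ℝ)))
    {A : ℕ → Set Ω} (hA : ∀ n, MeasurableSet[ℬ n] (A n)) {C : ℝ} (hC : 0 < C)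
    (hdeg : ∀ n, 1 ≤ n → ∀ t, ∀ᵐ ω ∂P, ω ∈ A n → (condDependencyDegree P ℬ μ (η t) n ω : ℝ≥0∞) ≤
      ENNReal.ofReal (C * (2 : ℝ) ^ (δ * (n : ℝ))))
    {ρ : ℝ≥0} (hρ : 0 < ρ) (γ : ℝ) :
    ∃ (c : ℝ) (n₀ : ℕ), 0 < c ∧ ∀ n, n₀ ≤ n → ∀ t,
      P {ω | ω ∈ A n ∧ (ρ * (2 ^ γ) ^ n : ℝ≥0) + (1 + ρ : ℝ≥0) * sliceMass (μ n ω) (η t) ≤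
        sliceMass (μ (n + 1) ω) (η t)} ≤
      ENNReal.ofReal (Real.exp (-(c * (2 : ℝ) ^ ((γ - (α + δ - κ)) * (n : ℝ))))) := by
  obtain ⟨S, hSb, hSm, hS⟩ := hμ.exists_isBounded_support
  obtain ⟨L, hL⟩ := hμ.quotients_bounded
  obtain ⟨C', n₀, hC', hF⟩ := hfrostman.exists_forall_dyadicCube_le
  have hbdd : ∀ n, ∃ R : ℝ, ∀ᵐ ω ∂P, ∀ x, (μ n ω x : ℝ) ≤ R := fun n =>
    ⟨(2 : ℝ) ^ (α * (n : ℝ)), hdensity.mono fun ω h x => h n x⟩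
  -- The factor `C + 1` absorbs `D + 1`, as `2 ^ (δ * n) ≥ 1`; `L ^ 2 + 1` keeps `K` positive even
  -- if `L = 0`.
  set K : ℝ := (C + 1) * ((L ^ 2 + 1) * C') with hKdef
  have hK : 0 < K := by positivity
  refine ⟨ρ ^ 2 / (2 * K), max n₀ 1, by positivity, fun n hn t => ?_⟩
  have hn₀ : n₀ ≤ n + 1 := (le_of_max_le_left hn).trans n.le_succ
  have hn1 : 1 ≤ n := le_of_max_le_right hn
  have := hη t
  obtain ⟨s, hs⟩ := exists_finset_dyadicCube_cover (n + 1) hSb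
  have hKn : 0 < (K * (2 : ℝ) ^ ((α + δ - κ) * (n : ℝ))).toNNReal :=
    Real.toNNReal_pos.2 (by positivity)
  refine (hμ.measure_sliceMass_succ_ge_le hbdd (η t) (s := s)
    (hS.mono fun ω h m => (h m).trans hs) (hL.mono fun ω h x => h n x) (hA n)
    (r := ((2 : ℝ) ^ (α * (n : ℝ))).toNNReal * (C' * (2 : ℝ) ^ (-κ * (n + 1 : ℕ))).toNNReal)
    (D := (C * (2 : ℝ) ^ (δ * (n : ℝ))).toNNReal) (hdeg n hn1 t) ?_ hKn ?_ ρ ((2 ^ γ) ^ n)).trans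
    (ENNReal.ofReal_le_ofReal (Real.exp_le_exp.2 (le_of_eq ?_)))
  · filter_upwards [hdensity] with ω hω k _
    refine (slice_le (B := ((2 : ℝ) ^ (α * (n : ℝ))).toNNReal)
      (fun x => NNReal.le_toNNReal_of_coe_le (hω n x))
      (measurableSet_dyadicCube (n + 1) k)).trans ?_
    rw [ENNReal.coe_mul]
    gcongr
    exact hF (n + 1) hn₀ t k
  · rw [← NNReal.coe_le_coe]
    push_cast
    rw [Real.coe_toNNReal _ (by positivity), Real.coe_toNNReal _ (by positivity),
      Real.coe_toNNReal _ (by positivity), Real.coe_toNNReal _ (by positivity)]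
    have h1 : (1 : ℝ) ≤ 2 ^ (δ * (n : ℝ)) := Real.one_le_rpow one_le_two (by positivity)
    have h2 : (2 : ℝ) ^ (-κ * ((n : ℝ) + 1)) ≤ 2 ^ (-κ * (n : ℝ)) :=
      Real.rpow_le_rpow_of_exponent_le one_le_two (by nlinarith)
    have h3 : (2 : ℝ) ^ ((α + δ - κ) * (n : ℝ)) =
        2 ^ (δ * (n : ℝ)) * (2 ^ (α * (n : ℝ)) * 2 ^ (-κ * (n : ℝ))) := by
      rw [← Real.rpow_add two_pos, ← Real.rpow_add two_pos]
      ring_nf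
    calc (C * (2 : ℝ) ^ (δ * (n : ℝ)) + 1) *
          (L ^ 2 * (2 ^ (α * (n : ℝ)) * (C' * 2 ^ (-κ * ((n : ℝ) + 1)))))
        ≤ (C * (2 : ℝ) ^ (δ * (n : ℝ)) + 2 ^ (δ * (n : ℝ))) *
          ((L ^ 2 + 1) * (2 ^ (α * (n : ℝ)) * (C' * 2 ^ (-κ * (n : ℝ))))) := by
          gcongr
          exact le_add_of_nonneg_right zero_le_one
      _ = _ := by rw [h3, hKdef]; ring
  · rw [Real.coe_toNNReal _ (by positivity)]
    push_cast
    generalize α + δ - κ = θ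
    rw [sub_mul, Real.rpow_sub two_pos, ← Real.rpow_natCast (2 ^ γ) n,
      ← Real.rpow_mul zero_le_two]
    field_simp

/-- Almost surely on the good events, the masses eventually grow at most by a factor `1 + ρ` in one
step, up to an error `O(2^{γ n})`, simultaneously for at most exponentially many parameters. -/
theorem IsMartingaleMeasure.ae_eventually_sliceMass_succ_le
    (hμ : IsMartingaleMeasure P ℬ μ) (hη : ∀ t, IsLocallyFiniteMeasure (η t)) (hκ : 0 < κ)
    (hδ : 0 ≤ δ) (hfrostman : HasFrostmanExponent η κ)
    (hdensity : ∀ᵐ ω ∂P, ∀ (n : ℕ) (x : Space M), (μ n ω x : ℝ) ≤ (2 : ℝ) ^ (α * (n : ℝ)))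
    {A : ℕ → Set Ω} (hA : ∀ n, MeasurableSet[ℬ n] (A n)) {C : ℝ} (hC : 0 < C)
    (hdeg : ∀ n, 1 ≤ n → ∀ t, ∀ᵐ ω ∂P, ω ∈ A n → (condDependencyDegree P ℬ μ (η t) n ω : ℝ≥0∞) ≤
      ENNReal.ofReal (C * (2 : ℝ) ^ (δ * (n : ℝ))))
    {ρ : ℝ≥0} (hρ : 0 < ρ) (hlt : α + δ - κ < γ) {F : ℕ → Finset Γ} {a : ℝ}
    (hF : ∀ n, 1 ≤ n → ((F n).card : ℝ) ≤ Real.exp (a * n)) :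
    ∀ᵐ ω ∂P, ∃ N, ∀ n, N ≤ n → ω ∈ A n → ∀ t ∈ F (n + 1),
      sliceMass (μ (n + 1) ω) (η t) ≤
        (ρ * (2 ^ γ) ^ n : ℝ≥0) + (1 + ρ : ℝ≥0) * sliceMass (μ n ω) (η t) := by
  obtain ⟨c, n₀, hc, hP⟩ := hμ.exists_forall_measure_sliceMass_succ_ge_le hη hκ hδ hfrostman
    hdensity hA hC hdeg hρ γ
  set E : ℕ → Γ → Set Ω := fun n t =>
    {ω | ω ∈ A n ∧ (ρ * (2 ^ γ) ^ n : ℝ≥0) + (1 + ρ : ℝ≥0) * sliceMass (μ n ω) (η t) ≤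
        sliceMass (μ (n + 1) ω) (η t)}
  set g : ℕ → ℝ := fun n => Real.exp (a * (n + 1 : ℝ)) *
    Real.exp (-(c * (2 : ℝ) ^ ((γ - (α + δ - κ)) * n)))
  have hgs : Summable g := summable_exp_mul_exp_neg_two_rpow a hc (by linarith)
  have hbound : ∀ n, n₀ ≤ n → P (⋃ t ∈ F (n + 1), E n t) ≤ ENNReal.ofReal (g n) := by
    intro n hn
    calc P (⋃ t ∈ F (n + 1), E n t) ≤ ∑ t ∈ F (n + 1), P (E n t) :=
          measure_biUnion_finset_le _ _
      _ ≤ ∑ _t ∈ F (n + 1),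
          ENNReal.ofReal (Real.exp (-(c * (2 : ℝ) ^ ((γ - (α + δ - κ)) * (n : ℝ))))) :=
          Finset.sum_le_sum fun t _ => hP n hn t
      _ ≤ _ := by
          rw [Finset.sum_const, nsmul_eq_mul, ← ENNReal.ofReal_natCast,
            ← ENNReal.ofReal_mul (by positivity)]
          apply ENNReal.ofReal_le_ofReal
          have h := hF (n + 1) (by omega)
          push_cast at h
          exact mul_le_mul_of_nonneg_right h (Real.exp_pos _).le
  have hBC : ∀ᵐ ω ∂P, ∀ᶠ m in Filter.atTop,
      ω ∉ ⋃ t ∈ F (m + n₀ + 1), E (m + n₀) t := by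
    refine ae_eventually_notMem (ne_top_of_le_ne_top ?_
      (ENNReal.tsum_le_tsum fun m => hbound (m + n₀) (Nat.le_add_left _ _)))
    rw [← ENNReal.ofReal_tsum_of_nonneg (fun n => by positivity)
      ((summable_nat_add_iff n₀).2 hgs)]
    exact ENNReal.ofReal_ne_top
  filter_upwards [hBC] with ω hω
  obtain ⟨N, hN⟩ := Filter.eventually_atTop.1 hω
  refine ⟨N + n₀, fun n hn hωA t ht => ?_⟩
  have h1 := hN (n - n₀) (by omega)
  rw [Nat.sub_add_cancel (by omega)] at h1
  simp only [Set.mem_iUnion, not_exists] at h1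
  by_contra hcon
  exact h1 t ht ⟨hωA, (not_le.1 hcon).le⟩

end

end SpatialMartingale

/-! ### Recursion for the supremum over all parameters. -/

theorem mainTheorem11 {Ω Γ : Type*} {mΩ : MeasurableSpace Ω} (P : Measure Ω)
    [IsProbabilityMeasure P] [MetricSpace Γ] (hΓ : TotallyBounded (Set.univ : Set Γ))
    {M : ℕ} (ℬ : Filtration ℕ mΩ) (μ : ℕ → Ω → SpatialMartingale.Space M → ℝ≥0)
    (η : Γ → Measure (SpatialMartingale.Space M))
    (hη : ∀ t, IsLocallyFiniteMeasure (η t))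
    (α κ δ γ : ℝ) (hα : 0 < α) (hκ : 0 < κ) (hδ : 0 ≤ δ) (hγ : 0 < γ)
    (hμ : SpatialMartingale.IsWSDM P ℬ μ η δ)
    (hbox : SpatialMartingale.HasFiniteBoxDimension Γ)
    (hfrostman : SpatialMartingale.HasFrostmanExponent η κ)
    (hdensity : ∀ᵐ ω ∂P, ∀ (n : ℕ) (x : SpatialMartingale.Space M),
      (μ n ω x : ℝ) ≤ (2 : ℝ) ^ (α * (n : ℝ)))
    (happrox : SpatialMartingale.HasFiniteApproximation P μ η γ)
    (hpos : 0 < α + δ - κ) (hlt : α + δ - κ < γ) :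
    ∀ᵐ ω ∂P, (⨆ (n : ℕ) (t : Γ),
      ENNReal.ofReal ((2 : ℝ) ^ (-γ * (n : ℝ))) *
        SpatialMartingale.sliceMass (μ n ω) (η t)) < ∞ := by
  obtain ⟨hmart, Ψ, -, hΨ, hgood⟩ := hμ
  obtain ⟨F, ⟨a, hF⟩, happ⟩ := happrox
  set w : ℝ≥0 := 2 ^ γ with hw
  have hw1 : 1 < w := NNReal.one_lt_rpow one_lt_two hγ
  have hw0 : w ≠ 0 := (zero_lt_one.trans hw1).ne'
  -- The growth factor `1 + ρ` must lose to the normalisation `2 ^ γ`; there is room because `γ >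
  -- 0`.
  obtain ⟨ρ, hρ, hρw⟩ : ∃ ρ : ℝ≥0, 0 < ρ ∧ 1 + ρ < w := by
    obtain ⟨x, hx1, hx2⟩ := exists_between hw1
    exact ⟨x - 1, tsub_pos_of_lt hx1, by rwa [add_tsub_cancel_of_le hx1.le]⟩
  have hweight : ∀ n : ℕ, ENNReal.ofReal ((2 : ℝ) ^ (-γ * (n : ℝ))) = ((w⁻¹ ^ n : ℝ≥0) : ℝ≥0∞) := by
    intro n
    rw [← ENNReal.ofReal_coe_nnreal]
    congr 1
    push_cast
    rw [hw, Real.rpow_mul zero_le_two, Real.rpow_natCast, Real.rpow_neg zero_le_two]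
    simp
  have hweight' : ∀ n : ℕ, ENNReal.ofReal ((2 : ℝ) ^ (γ * (n : ℝ))) = ((w ^ n : ℝ≥0) : ℝ≥0∞) := by
    intro n
    rw [← ENNReal.ofReal_coe_nnreal]
    congr 1
    push_cast
    rw [hw, Real.rpow_mul zero_le_two, Real.rpow_natCast]
    simp
  have hfin := hmart.ae_iSup_sliceMass_lt_top hfrostman hdensity
  -- The good events depend on `ε`, so the exceptional set is bounded for each `ε` and is null only
  -- in the limit.
  have hsmall : ∀ ε : ℝ, 0 < ε → P {ω | ¬ (⨆ (n : ℕ) (t : Γ),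
      ENNReal.ofReal ((2 : ℝ) ^ (-γ * (n : ℝ))) *
        SpatialMartingale.sliceMass (μ n ω) (η t)) < ∞} ≤ ENNReal.ofReal ε := by
    intro ε hε
    obtain ⟨C, e, A, hC, he, hes, heε, hA0, hA, hAΨ, hcond⟩ := hgood ε hε
    have hev := hmart.ae_eventually_sliceMass_succ_le hη hκ hδ hfrostman hdensity hA hC
      (fun n hn t => (hΨ n t).mono fun ω h hω => h.trans (hAΨ n hn ω hω)) hρ hlt hF
    refine (measure_mono_ae (t := ⋃ n, (A n)ᶜ) ?_).trans
      ((SpatialMartingale.measure_iUnion_compl_le_of_condExp_ge he hes hA0 hA hcond).trans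
        (ENNReal.ofReal_le_ofReal heε.le))
    filter_upwards [hev, happ, hfin] with ω ⟨N, hN⟩ ⟨K, C₁, hK⟩ hfin hbad
    by_contra hωA
    have hωA : ∀ n, ω ∈ A n := fun n => by
      by_contra h
      exact hωA (Set.mem_iUnion.2 ⟨n, h⟩)
    refine hbad ?_
    set T : ℕ → ℝ≥0∞ := fun n => ⨆ t, SpatialMartingale.sliceMass (μ n ω) (η t) with hT
    -- Finite approximation at level `n + 1` reduces to `t ∈ F (n + 1)`; after the one-step bound,
    -- `Y_n^t` is dominated by the full supremum `T n`, closing the recursion.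
    have hrec : ∀ n, max N K ≤ n →
        T (n + 1) ≤ (ρ * w ^ n : ℝ≥0) + (1 + ρ : ℝ≥0) * T n + (C₁.toNNReal * w ^ (n + 1) : ℝ≥0) := by
      intro n hn
      refine (hK (n + 1) ((le_of_max_le_right hn).trans n.le_succ)).trans ?_
      rw [ENNReal.ofReal_mul' (by positivity), hweight', ENNReal.coe_mul C₁.toNNReal]
      refine add_le_add (iSup₂_le fun t ht => ?_) le_rfl
      refine (hN n (le_of_max_le_left hn) (hωA n) t ht).trans ?_
      gcongr
      exact le_iSup (fun t => SpatialMartingale.sliceMass (μ n ω) (η t)) t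
    have hW := SpatialMartingale.iSup_lt_top_of_contraction
      (W := fun n => ((w⁻¹ ^ n : ℝ≥0) : ℝ≥0∞) * T n)
      (fun n => (ENNReal.mul_lt_top ENNReal.coe_lt_top (hfin n)).ne)
      (q := w⁻¹ * (1 + ρ)) (c := w⁻¹ * ρ + C₁.toNNReal) (N := max N K)
      (by rwa [inv_mul_lt_iff₀ (zero_lt_one.trans hw1), mul_one]) ?_
    · simpa only [hweight, hT, ENNReal.mul_iSup] using hW
    · intro n hn
      have h1 : (w⁻¹ ^ (n + 1) * (ρ * w ^ n) : ℝ≥0) = w⁻¹ * ρ := by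
        rw [inv_pow, pow_succ]
        field_simp
      have h2 : (w⁻¹ ^ (n + 1) * (C₁.toNNReal * w ^ (n + 1)) : ℝ≥0) = C₁.toNNReal := by
        rw [inv_pow]
        field_simp
      calc ((w⁻¹ ^ (n + 1) : ℝ≥0) : ℝ≥0∞) * T (n + 1)
          ≤ ((w⁻¹ ^ (n + 1) : ℝ≥0) : ℝ≥0∞) * ((ρ * w ^ n : ℝ≥0) + (1 + ρ : ℝ≥0) * T n +
            (C₁.toNNReal * w ^ (n + 1) : ℝ≥0)) := by gcongr; exact hrec n hn
        _ = ((w⁻¹ ^ (n + 1) * (ρ * w ^ n) : ℝ≥0) : ℝ≥0∞) +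
            ((w⁻¹ ^ (n + 1) : ℝ≥0) : ℝ≥0∞) * (1 + ρ : ℝ≥0) * T n +
            ((w⁻¹ ^ (n + 1) * (C₁.toNNReal * w ^ (n + 1)) : ℝ≥0) : ℝ≥0∞) := by
          rw [ENNReal.coe_mul (w⁻¹ ^ (n + 1)) (ρ * w ^ n),
            ENNReal.coe_mul (w⁻¹ ^ (n + 1)) (C₁.toNNReal * w ^ (n + 1))]
          ring
        _ = _ := by
          rw [h1, h2, pow_succ]
          push_cast
          ring
  rw [ae_iff]
  refine le_antisymm (ENNReal.le_of_forall_pos_le_add fun ε hε _ => ?_) zero_le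
  simpa using hsmall ε hε
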